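/- Let $d\ge 0$. A \emph{polyhedral cone} in $\mathbb R^d$ is an intersection of finitely many closed half-spaces of the form $\{x : \langle a,x\rangle\le 0\}$; let $\mathcal P(\mathbb R^d)$ be the set of polyhedral cones. Let $\hat{\mathcal B}(\mathbb R^d)$ be the $\sigma$-algebra of \emph{conic Borel sets}, i.e. Borel sets $M\subseteq\mathbb R^d$ with $\lambda M=M$ for all $\lambda>0$, and call a $\sigma$-additive function $\hat{\mathcal B}(\mathbb R^d)\to\mathbb R$ a \emph{conic measure}. A \emph{face} of $C\in\mathcal P(\mathbb R^d)$ is a set $\{x\in C : \langle x,z\rangle=0\}$ with $z\in\mathbb R^d$ such that $\langle x,z\rangle\le 0$ for all $x\in C$. Let $\mathcal L_k(C)$ be the (finite) set of $k$-dimensional linear spans of faces of $C$, and let $S_k(C)=\bigcup_{L\in\mathcal L_k(C)}\operatorname{int}_L(C\cap L)$ be the $k$-skeleton of $C$, where $\operatorname{int}_L$ is the interior relative to $L$. With $\Delta$ the Dirac measure at $0$ and $\gamma_L$ the standard Gaussian measure on a linear subspace $L$ (so $\gamma_{\{0\}}=\Delta$), define for $0\le k\le d$, $C\in\mathcal P(\mathbb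 R^d)$ and $M\in\hat{\mathcal B}(\mathbb R^d)$ the \emph{lineality measures} and the \emph{polyhedral measures} $$\operatorname{Lin}_k(C,M)=\begin{cases}\Delta(M)&\text{if }\dim(C\cap(-C))=k,\\0&\text{otherwise,}\end{cases}\qquad \Psi_k(C,M)=\sum_{L\in\mathcal L_k(C)}\gamma_L(C\cap L\cap M).$$ \textbf{Theorem (Characterization of polyhedral measures).} Let $\psi\colon\mathcal P(\mathbb R^d)\times\hat{\mathcal B}(\mathbb R^d)\to\mathbb R$ be such that for all $C,D\in\mathcal P(\mathbb R^d)$, $M\in\hat{\mathcal B}(\mathbb R^d)$ and all orthogonal transformations $Q\in O(d)$: \begin{enumerate} \item[(0)] $\psi(C,\cdot)$ is a conic measure; \item[(1)] $\psi(C,M)=\psi(C,M\cap C)$; \item[(2)] $\psi(QC,QM)=\psi(C,M)$; \item[(3)] $\psi(C,M)=\psi(D,M)$ if $S_k(C)\cap M=S_k(D)\cap M$ for $k=0,\dots,d$. \end{enumerate} Then $\psi$ is a linear combination of $\operatorname{Lin}_d,\dots,\operatorname{Lin}_1,\operatorname{Lin}_0=\Psi_0,\Psi_1,\dots,\Psi_d$.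 Explicitly, $$\psi=\sum_{k=0}^d\psi(L^{(k)},\{0\})\,\operatorname{Lin}_k+\sum_{k=1}^d\psi(L^{(k)},\mathbb R^d\setminus\{0\})\,\Psi_k,$$ where, for each $k$, $L^{(k)}\subseteq\mathbb R^d$ is any $k$-dimensional linear subspace. -/

import Mathlib

open MeasureTheory ProbabilityTheory
open scoped Pointwise

noncomputable section

namespace Conic

/-- The Euclidean space `ℝ^d`. -/
abbrev E (d : ℕ) : Type := EuclideanSpace ℝ (Fin d)

/-! ### Polyhedral cones -/

/-- Polyhedral cones in `ℝ^d`: intersections of finitely many closed half-spaces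
`{y | 0 ≤ ⟪x, y⟫}`. -/
def PolyhedralCone (d : ℕ) : Type :=
  {C : PointedCone ℝ (E d) // C.DualFG (innerₗ (E d))}

namespace PolyhedralCone

variable {d : ℕ}

/-- The underlying set of a polyhedral cone. -/
def carrier (C : PolyhedralCone d) : Set (E d) := (C.1 : Set (E d))

theorem exists_halfspaces (C : PolyhedralCone d) :
    ∃ s : Finset (E d), ∀ y, y ∈ C.carrier ↔ ∀ x ∈ s, 0 ≤ inner ℝ x y := by
  obtain ⟨s, hs⟩ := C.2
  refine ⟨s, fun y => ?_⟩
  simp [carrier, ← hs, PointedCone.mem_dual]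

theorem isClosed_carrier (C : PolyhedralCone d) : IsClosed C.carrier := by
  obtain ⟨s, hs⟩ := C.exists_halfspaces
  have : C.carrier = ⋂ x ∈ s, {y | 0 ≤ inner ℝ x y} := by
    ext y; simp [hs]
  rw [this]
  exact isClosed_biInter fun x _ => isClosed_le continuous_const (by fun_prop)

/-- A linear subspace, seen as a polyhedral cone. -/
def ofSubspace (L : Submodule ℝ (E d)) : PolyhedralCone d :=
  ⟨PointedCone.ofSubmodule L, by
    classical
    obtain ⟨t, ht⟩ := (IsNoetherian.noetherian Lᗮ : (Lᗮ).FG)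
    refine ⟨t ∪ t.image (fun x => -x), ?_⟩
    ext y
    rw [PointedCone.mem_ofSubmodule_iff, ← Submodule.orthogonal_orthogonal L, ← ht,
      Submodule.mem_orthogonal]
    constructor
    · intro h u hu
      induction hu using Submodule.span_induction with
      | mem x hx =>
        have h1 : 0 ≤ inner ℝ x y := by
          have := PointedCone.mem_dual.1 h (x := x) (by simp [Finset.mem_coe.1 hx])
          simpa using this
        have h2 : 0 ≤ inner ℝ (-x) y := by
          have := PointedCone.mem_dual.1 h (x := -x) (by simp [Finset.mem_coe.1 hx])
          simpa using this
        rw [inner_neg_left] at h2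
        linarith
      | zero => simp
      | add a b _ _ ha hb => rw [inner_add_left, ha, hb, add_zero]
      | smul r a _ ha => rw [inner_smul_left, ha, mul_zero]
    · intro h
      refine PointedCone.mem_dual.2 fun x hx => ?_
      have key : inner ℝ x y = 0 := by
        have hx' : x ∈ t ∨ -x ∈ t := by
          simpa [neg_eq_iff_eq_neg] using hx
        rcases hx' with hx' | hx'
        · exact h x (Submodule.subset_span hx')
        · have := h (-x) (Submodule.subset_span hx')
          rwa [inner_neg_left, neg_eq_zero] at this
      simp [key]⟩

/-- The image `Q C` of a polyhedral cone under an orthogonal transformation. -/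
def rotate (Q : E d ≃ₗᵢ[ℝ] E d) (C : PolyhedralCone d) : PolyhedralCone d :=
  ⟨C.1.map (Q.toLinearEquiv : E d →ₗ[ℝ] E d), by
    classical
    obtain ⟨s, hs⟩ := C.2
    refine ⟨s.image Q, ?_⟩
    ext y
    rw [PointedCone.mem_map, ← hs]
    simp only [PointedCone.mem_dual]
    constructor
    · intro h
      refine ⟨Q.symm y, fun x hx => ?_, by simp⟩
      have := h (x := Q x) (by simpa using hx)
      simpa [← Q.inner_map_map x (Q.symm y)] using this
    · rintro ⟨x, hx, rfl⟩ z hz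
      obtain ⟨w, hw, rfl⟩ : ∃ w ∈ s, Q w = z := by simpa using hz
      simpa using hx hw⟩

/-- `F` is a face of `C`: it is cut out of `C` by a supporting hyperplane
(or `F = C`, with `z = 0`). -/
def IsFace (C : PolyhedralCone d) (F : Set (E d)) : Prop :=
  ∃ z : E d, (∀ x ∈ C.carrier, inner ℝ x z ≤ 0) ∧ F = {x ∈ C.carrier | inner ℝ x z = 0}

/-- `𝓛_k(C)`: the `k`-dimensional linear spans of faces of `C`. -/
def faceSpans (C : PolyhedralCone d) (k : ℕ) : Set (Submodule ℝ (E d)) :=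
  {L | (∃ F, C.IsFace F ∧ L = Submodule.span ℝ F) ∧ Module.finrank ℝ L = k}

/-- The interior of `A ∩ L` relative to the linear subspace `L`. -/
def relInterior (L : Submodule ℝ (E d)) (A : Set (E d)) : Set (E d) :=
  ((↑) : L → E d) '' interior (((↑) : L → E d) ⁻¹' A)

/-- The `k`-skeleton `S_k(C)`: the union of the relative interiors of the `k`-dimensional faces. -/
def skeleton (C : PolyhedralCone d) (k : ℕ) : Set (E d) :=
  ⋃ L ∈ C.faceSpans k, relInterior L C.carrier

/-- The lineality `dim (C ∩ -C)` of a cone. -/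
def lin (C : PolyhedralCone d) : ℕ := Module.finrank ℝ C.1.lineal

theorem finite_isFace (C : PolyhedralCone d) : {F | C.IsFace F}.Finite := by
  classical
  obtain ⟨s, hs⟩ := C.exists_halfspaces
  -- every face is cut out by turning some of the defining inequalities into equalities
  refine (s.powerset.finite_toSet.image
    (fun I : Finset (E d) => {y ∈ C.carrier | ∀ a ∈ I, inner ℝ a y = 0})).subset ?_
  rintro F ⟨z, hz, rfl⟩
  set F : Set (E d) := {x ∈ C.carrier | inner ℝ x z = 0} with hF
  set I : Finset (E d) := s.filter (fun a => ∀ y ∈ F, inner ℝ a y = 0) with hI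
  refine ⟨I, Finset.mem_coe.2 (Finset.mem_powerset.2 (Finset.filter_subset _ _)), ?_⟩
  -- a point of the face at which all the other inequalities are strict
  have hw : ∀ t ⊆ s \ I, ∃ x ∈ F, ∀ a ∈ t, 0 < inner ℝ a x := by
    intro t
    induction t using Finset.induction_on with
    | empty =>
      intro _
      exact ⟨0, ⟨(hs 0).2 (by simp), by simp⟩, by simp⟩
    | insert b t hb ih =>
      intro ht
      obtain ⟨x, hx, hxt⟩ := ih (fun a ha => ht (Finset.mem_insert_of_mem ha))
      have hbI := ht (Finset.mem_insert_self b t)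
      have : ∃ y ∈ F, inner ℝ b y ≠ 0 := by
        by_contra hcon
        push Not at hcon
        have h := Finset.mem_sdiff.1 hbI
        exact h.2 (Finset.mem_filter.2 ⟨h.1, hcon⟩)
      obtain ⟨y, hy, hby⟩ := this
      have hxs := (hs x).1 hx.1
      have hys := (hs y).1 hy.1
      refine ⟨x + y, ⟨(hs _).2 fun a ha => ?_, ?_⟩, fun a ha => ?_⟩
      · rw [inner_add_right]; exact add_nonneg (hxs a ha) (hys a ha)
      · rw [inner_add_left, hx.2, hy.2, add_zero]
      · rw [inner_add_right]
        rcases Finset.mem_insert.1 ha with rfl | ha'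
        · have hbs := (Finset.mem_sdiff.1 hbI).1
          exact add_pos_of_nonneg_of_pos (hxs _ hbs) (lt_of_le_of_ne (hys _ hbs) hby.symm)
        · exact add_pos_of_pos_of_nonneg (hxt a ha')
            (hys a (Finset.mem_sdiff.1 (ht (Finset.mem_insert_of_mem ha'))).1)
  obtain ⟨x, hx, hxp⟩ := hw (s \ I) subset_rfl
  ext y
  constructor
  · rintro ⟨hyC, hyI⟩
    refine ⟨hyC, le_antisymm (hz y hyC) ?_⟩
    -- a small step from `x` in direction `-y` stays in the cone
    have hev : ∀ᶠ ε : ℝ in nhds 0, ∀ a ∈ s \ I, 0 < inner ℝ a (x - ε • y) := by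
      rw [Filter.eventually_all_finset]
      intro a ha
      have hc : Continuous fun ε : ℝ => (inner ℝ a (x - ε • y) : ℝ) := by fun_prop
      exact hc.continuousAt.eventually (lt_mem_nhds (by simpa using hxp a ha))
    obtain ⟨ε, hε, hε0⟩ :=
      ((hev.filter_mono nhdsWithin_le_nhds).and
        (self_mem_nhdsWithin : Set.Ioi (0 : ℝ) ∈ nhdsWithin 0 (Set.Ioi 0))).exists
    have hmem : x - ε • y ∈ C.carrier := by
      refine (hs _).2 fun a ha => ?_
      by_cases haI : a ∈ I
      · rw [inner_sub_right, inner_smul_right, hyI a haI, (Finset.mem_filter.1 haI).2 x hx]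
        simp
      · exact (hε a (Finset.mem_sdiff.2 ⟨ha, haI⟩)).le
    have h := hz _ hmem
    rw [inner_sub_left, real_inner_smul_left, hx.2] at h
    have hε0' : 0 < ε := hε0
    by_contra hneg
    push Not at hneg
    nlinarith
  · intro hy
    exact ⟨hy.1, fun a ha => (Finset.mem_filter.1 ha).2 y hy⟩

theorem finite_faceSpans (C : PolyhedralCone d) (k : ℕ) : (C.faceSpans k).Finite := by
  refine (C.finite_isFace.image (fun F => Submodule.span ℝ F)).subset ?_
  rintro L ⟨⟨F, hF, rfl⟩, -⟩
  exact ⟨F, hF, rfl⟩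

end PolyhedralCone

/-! ### Conic Borel sets and conic measures -/

/-- The conic Borel `σ`-algebra: Borel sets `M` with `r M = M` for all `r > 0`. -/
@[reducible] def conicBorel (d : ℕ) : MeasurableSpace (E d) where
  MeasurableSet' M := MeasurableSet M ∧ ∀ r : ℝ, 0 < r → r • M = M
  measurableSet_empty := ⟨MeasurableSet.empty, fun r _ => Set.smul_set_empty⟩
  measurableSet_compl M hM :=
    ⟨hM.1.compl, fun r hr => by
      ext x
      rw [Set.mem_smul_set_iff_inv_smul_mem₀ hr.ne', Set.mem_compl_iff, Set.mem_compl_iff,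
        ← Set.mem_smul_set_iff_inv_smul_mem₀ hr.ne', hM.2 r hr]⟩
  measurableSet_iUnion f hf :=
    ⟨MeasurableSet.iUnion fun i => (hf i).1, fun r hr => by
      rw [Set.smul_set_iUnion]
      exact Set.iUnion_congr fun i => (hf i).2 r hr⟩

/-- Conic Borel sets in `ℝ^d`. -/
def ConicSet (d : ℕ) : Type := {M : Set (E d) // MeasurableSet[conicBorel d] M}

namespace ConicSet

variable {d : ℕ}

/-- The conic set `{0}`. -/
def origin (d : ℕ) : ConicSet d :=
  ⟨{0}, MeasurableSet.singleton 0, fun r _ => by simp⟩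

/-- The conic set `ℝ^d \ {0}`. -/
def punctured (d : ℕ) : ConicSet d :=
  ⟨{0}ᶜ, (origin d).2.compl⟩

/-- The conic set `M ∩ C`. -/
def interCone (M : ConicSet d) (C : PolyhedralCone d) : ConicSet d :=
  ⟨M.1 ∩ C.carrier, M.2.1.inter C.isClosed_carrier.measurableSet, fun r hr => by
    rw [Set.smul_set_inter₀ hr.ne', M.2.2 r hr]
    congr 1
    ext x
    rw [Set.mem_smul_set_iff_inv_smul_mem₀ hr.ne']
    constructor
    · intro h
      have := C.1.smul_mem hr.le h
      rwa [smul_inv_smul₀ hr.ne'] at this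
    · intro h
      exact C.1.smul_mem (inv_nonneg.2 hr.le) h⟩

/-- The image `Q M` of a conic set under an orthogonal transformation. -/
def rotate (Q : E d ≃ₗᵢ[ℝ] E d) (M : ConicSet d) : ConicSet d :=
  ⟨Q '' M.1, Q.toHomeomorph.toMeasurableEquiv.measurableSet_image.2 M.2.1, fun r hr => by
    conv_rhs => rw [← M.2.2 r hr]
    exact (Set.image_smul_comm Q r M.1 fun x => Q.map_smul r x).symm⟩

end ConicSet

/-- A conic measure: a `σ`-additive real-valued (signed) function on the conic Borel sets. -/
def IsConicMeasure {d : ℕ} (μ : ConicSet d → ℝ) : Prop :=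
  ∃ m : @SignedMeasure (E d) (conicBorel d), ∀ M : ConicSet d, μ M = m M.1

/-! ### Lineality measures and polyhedral measures -/

open Classical in
/-- The lineality measure `Lin_k(C, M)`, which is `Δ(M)` if `lin C = k` and `0` otherwise. -/
def linMeasure {d : ℕ} (k : ℕ) (C : PolyhedralCone d) (M : ConicSet d) : ℝ :=
  (if C.lin = k then 1 else 0) * (Measure.dirac (0 : E d)).real M.1

/-- The standard Gaussian measure `γ_L` on a linear subspace `L`, as a measure on `ℝ^d`. -/
def gaussianOn {d : ℕ} (L : Submodule ℝ (E d)) : Measure (E d) :=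
  (stdGaussian L).map ((↑) : L → E d)

/-- The polyhedral measure `Ψ_k(C, M) = ∑_{L ∈ 𝓛_k(C)} γ_L(C ∩ L ∩ M)`. -/
def polyMeasure {d : ℕ} (k : ℕ) (C : PolyhedralCone d) (M : ConicSet d) : ℝ :=
  ∑ L ∈ (C.finite_faceSpans k).toFinset, (gaussianOn L).real (C.carrier ∩ L ∩ M.1)

end Conic

end

noncomputable section

namespace Conic

/-! ### Signed measures invariant under reflections -/

section Reflection

variable {V : Type*} [NormedAddCommGroup V] [InnerProductSpace ℝ V]

/-! The relative interiors of the faces partition a cone `C`, so σ-additivity and concentration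
reduce `ψ C M` to the origin and to pieces of `M` inside one relative interior
(`exists_mem_relInterior`, `faceSpans_eq_of_mem_relInterior`). On a piece lying in a face with span
`L`, the skeletons of `C` and of `L` agree, so locality replaces `C` by `L`
(`eq_ofSubspace_of_subset_relInterior`). The origin lies in the relative interior of the lineality
space, so `ψ C {0}` depends on `C.lin` alone; this yields the `Lin_k`.

Away from the origin, `ψ` of a subspace `L` is a conic measure invariant under the reflections of
`L`, hence a multiple of the Gaussian measure (`conicMeasure_eq_gaussianOn`). The factor depends
only on `dim L`, since orthogonal maps act transitively on subspaces of equal dimension. Relative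
boundaries are Gaussian null sets, so summing over faces gives the `Ψ_k`.

The uniqueness of the invariant measure is proved with characteristic functions: radial projection
turns a conic measure into a signed measure on the unit sphere of `L`, and reflection invariance
makes its characteristic function radial. Averaging that function over a sphere and applying Fubini
determines it up to the total mass. -/

/-- The reflection in the hyperplane orthogonal to `w`. -/
def hyperplaneReflection (w : V) : V ≃ₗᵢ[ℝ] V := (ℝ ∙ w)ᗮ.reflection

theorem hyperplaneReflection_involutive (w : V) :
    Function.Involutive (hyperplaneReflection w) :=
  Submodule.reflection_involutive _

theorem hyperplaneReflection_apply (w x : V) :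
    hyperplaneReflection w x = x - (2 * (inner ℝ w x / ((‖w‖ : ℝ) ^ 2))) • w := by
  rw [hyperplaneReflection, Submodule.reflection_orthogonal_apply,
    Submodule.reflection_singleton_apply]
  simp only [RCLike.ofReal_real_eq_id, id_eq, neg_sub, mul_smul, two_smul, ← add_smul]

theorem hyperplaneReflection_sub {x y : V} (h : ‖x‖ = ‖y‖) :
    hyperplaneReflection (x - y) x = y :=
  Submodule.reflection_sub h

theorem inner_hyperplaneReflection_left (w x y : V) :
    inner ℝ (hyperplaneReflection w x) y = inner ℝ x (hyperplaneReflection w y) := by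
  rw [← (hyperplaneReflection w).inner_map_map x, hyperplaneReflection_involutive w y]

variable [FiniteDimensional ℝ V] [MeasurableSpace V] [BorelSpace V]

theorem charFun_add_measure (p n : Measure V) [IsFiniteMeasure p] [IsFiniteMeasure n] (t : V) :
    charFun (p + n) t = charFun p t + charFun n t := by
  have h (μ : Measure V) [IsFiniteMeasure μ] :
      Integrable (fun x => Complex.exp ((inner ℝ x t : ℝ) * Complex.I)) μ := by
    refine Integrable.of_bound (C := 1) (by fun_prop) (.of_forall fun x => ?_)
    rw [Complex.norm_exp_ofReal_mul_I]
  simp only [charFun_apply]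
  exact integral_add_measure (h p) (h n)

theorem charFun_hyperplaneReflection (p : Measure V) (w t : V) :
    charFun p (hyperplaneReflection w t) = charFun (p.map (hyperplaneReflection w)) t := by
  rw [charFun_apply, charFun_apply, integral_map (by fun_prop) (by fun_prop)]
  simp only [inner_hyperplaneReflection_left]

/-- Fubini applies because the kernel `exp(i r ⟪x, u⟫)` is bounded and symmetric in `x` and `u`. -/
theorem integral_charFun_swap (p σ : Measure V) [IsFiniteMeasure p] [IsFiniteMeasure σ] (r : ℝ) :
    ∫ u, charFun p (r • u) ∂σ = ∫ x, charFun σ (r • x) ∂p := by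
  simp only [charFun_apply]
  rw [integral_integral_swap]
  · simp only [inner_smul_right, real_inner_comm]
  · refine Integrable.of_bound (C := 1) ?_ (.of_forall fun x => ?_)
    · refine Continuous.aestronglyMeasurable ?_
      unfold Function.uncurry
      fun_prop
    · simp only [Function.uncurry]
      rw [Complex.norm_exp_ofReal_mul_I]

/-- A reflection invariant signed measure on the sphere, written as `p - n`, is a multiple of
a reflection invariant probability measure. -/
theorem real_sub_real_eq_of_reflection_invariant (p n σ : Measure V) [IsFiniteMeasure p]
    [IsFiniteMeasure n] [IsProbabilityMeasure σ]
    (hp : ∀ᵐ x ∂p, ‖x‖ = 1) (hn : ∀ᵐ x ∂n, ‖x‖ = 1) (hσ : ∀ᵐ x ∂σ, ‖x‖ = 1)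
    (hpn : ∀ w : V, p.map (hyperplaneReflection w) + n = p + n.map (hyperplaneReflection w))
    (hinv : ∀ w : V, σ.map (hyperplaneReflection w) = σ) (A : Set V) :
    p.real A - n.real A = (p.real Set.univ - n.real Set.univ) * σ.real A := by
  -- Two vectors of equal norm are exchanged by a reflection, so invariance makes the characteristic
  -- function radial.
  have hg : ∀ s t : V, ‖s‖ = ‖t‖ → charFun σ s = charFun σ t := by
    intro s t h
    rw [← hyperplaneReflection_sub h, charFun_hyperplaneReflection, hinv]
  have hf : ∀ s t : V, ‖s‖ = ‖t‖ →
      charFun p s - charFun n s = charFun p t - charFun n t := by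
    intro s t h
    have h1 := congrArg (fun μ => charFun μ s) (hpn (s - t))
    have : IsFiniteMeasure (p.map (hyperplaneReflection (s - t))) := by infer_instance
    simp only [charFun_add_measure, ← charFun_hyperplaneReflection,
      hyperplaneReflection_sub h] at h1
    linear_combination -h1
  -- After swapping the integrals, the integrand is constant on the unit sphere, where `q` lives.
  have havg : ∀ (q : Measure V) [IsFiniteMeasure q], (∀ᵐ x ∂q, ‖x‖ = 1) → ∀ t : V,
      ∫ u, charFun q (‖t‖ • u) ∂σ = q.real Set.univ * charFun σ t := by
    intro q _ hq t
    rw [integral_charFun_swap]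
    have : (fun x => charFun σ (‖t‖ • x)) =ᵐ[q] fun _ => charFun σ t := by
      filter_upwards [hq] with x hx
      exact hg _ _ (by simp [norm_smul, hx])
    rw [integral_congr_ae this]
    simp
  have hint : ∀ (q : Measure V) [IsFiniteMeasure q] (t : V),
      Integrable (fun u => charFun q (‖t‖ • u)) σ := by
    intro q _ t
    refine Integrable.of_bound (C := q.real Set.univ) ?_ (.of_forall fun x => norm_charFun_le _)
    exact (measurable_charFun.comp (by fun_prop)).aestronglyMeasurable
  have key : ∀ t : V, charFun p t - charFun n t =
      (p.real Set.univ - n.real Set.univ : ℂ) * charFun σ t := by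
    intro t
    have h1 : ∫ u, (charFun p (‖t‖ • u) - charFun n (‖t‖ • u)) ∂σ =
        charFun p t - charFun n t := by
      have : (fun u => charFun p (‖t‖ • u) - charFun n (‖t‖ • u)) =ᵐ[σ]
          fun _ => charFun p t - charFun n t := by
        filter_upwards [hσ] with x hx
        exact hf _ _ (by simp [norm_smul, hx])
      rw [integral_congr_ae this]
      simp
    rw [← h1, integral_sub (hint p t) (hint n t), havg p hp, havg n hn]
    ring
  have hsmul : ∀ (c : NNReal) (t : V), charFun (c • σ) t = (c : ℂ) * charFun σ t := by
    intro c t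
    rw [charFun_apply, charFun_apply, integral_smul_nnreal_measure, NNReal.smul_def,
      Complex.real_smul]
  -- The identity `p - n = (p(V) - n(V)) σ`, rearranged so that both sides are positive measures and
  -- uniqueness of characteristic functions applies.
  have hm : p + (n Set.univ).toNNReal • σ = n + (p Set.univ).toNNReal • σ := by
    refine Measure.ext_of_charFun (funext fun t => ?_)
    rw [charFun_add_measure, charFun_add_measure, hsmul, hsmul]
    have := key t
    simp only [Measure.real, ENNReal.toReal] at this
    linear_combination this
  have h2 := congrArg (fun μ : Measure V => μ.real A) hm
  beta_reduce at h2
  rw [measureReal_add_apply, measureReal_add_apply, measureReal_nnreal_smul_apply,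
    measureReal_nnreal_smul_apply] at h2
  simp only [Measure.real, ENNReal.toReal] at h2 ⊢
  linear_combination h2

/-- The standard Gaussian measure, projected radially to the unit sphere. -/
def sphericalGaussian (V : Type*) [NormedAddCommGroup V] [InnerProductSpace ℝ V]
    [FiniteDimensional ℝ V] [MeasurableSpace V] : Measure V :=
  (stdGaussian V).map fun x => ‖x‖⁻¹ • x

theorem measurable_normalize : Measurable fun x : V => ‖x‖⁻¹ • x := by fun_prop

instance : IsProbabilityMeasure (sphericalGaussian V) :=
  Measure.isProbabilityMeasure_map measurable_normalize.aemeasurable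

/-- Normalization commutes with linear isometries, and the standard Gaussian is invariant under
them. -/
theorem sphericalGaussian_map (w : V) :
    (sphericalGaussian V).map (hyperplaneReflection w) = sphericalGaussian V := by
  have h : (hyperplaneReflection w : V → V) ∘ (fun x => ‖x‖⁻¹ • x) =
      (fun x => ‖x‖⁻¹ • x) ∘ hyperplaneReflection w := by
    ext x; simp
  rw [sphericalGaussian, Measure.map_map (by fun_prop) (by fun_prop), h,
    ← Measure.map_map (by fun_prop) (by fun_prop), stdGaussian_map]

/-- Hyperplanes are null sets of the standard Gaussian measure. -/
theorem stdGaussian_inner_eq_zero {a : V} (ha : a ≠ 0) :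
    stdGaussian V {y | inner ℝ a y = 0} = 0 := by
  have hG : IsGaussian ((stdGaussian V).map (innerSL ℝ a)) := by infer_instance
  -- The functional `⟪a, ·⟫` has law `N(0, ‖a‖²)`, which has no atoms because `a ≠ 0`.
  have hmap : (stdGaussian V).map (innerSL ℝ a) =
      gaussianReal 0 (‖a‖ ^ 2).toNNReal := by
    rw [IsGaussian.map_eq_gaussianReal, variance_dual_stdGaussian,
      integral_strongDual_stdGaussian]
    simp
  have hset : {y : V | inner ℝ a y = 0} = innerSL ℝ a ⁻¹' {0} := by
    ext; simp
  rw [hset, ← Measure.map_apply (by fun_prop) (measurableSet_singleton 0), hmap]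
  have : NullSingletonClass (gaussianReal 0 (‖a‖ ^ 2).toNNReal) := by
    refine nullSingletonClass_gaussianReal ?_
    simpa using ha
  exact measure_singleton 0

theorem stdGaussian_singleton_zero [Nontrivial V] : stdGaussian V {0} = 0 := by
  obtain ⟨a, ha⟩ := exists_ne (0 : V)
  exact measure_mono_null (by simp) (stdGaussian_inner_eq_zero ha)

theorem sphericalGaussian_norm_eq_one [Nontrivial V] :
    ∀ᵐ x ∂(sphericalGaussian V), ‖x‖ = 1 := by
  rw [sphericalGaussian, ae_map_iff (by fun_prop) (measurableSet_eq_fun (by fun_prop) (by fun_prop))]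
  have : ∀ᵐ x ∂(stdGaussian V), x ≠ 0 := by
    rw [ae_iff]; simpa using stdGaussian_singleton_zero
  filter_upwards [this] with x hx
  exact norm_smul_inv_norm (𝕜 := ℝ) hx

/-- A signed measure which is invariant under reflections on the unit sphere is there a multiple of
the normalized Gaussian measure. -/
theorem signedMeasure_eq_sphericalGaussian [Nontrivial V] (ν : SignedMeasure V)
    (hν : ∀ (w : V) (A : Set V), MeasurableSet A → A ⊆ Metric.sphere 0 1 →
      ν (hyperplaneReflection w ⁻¹' A) = ν A)
    {A : Set V} (hA : MeasurableSet A) :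
    ν (A ∩ Metric.sphere 0 1) = ν (Metric.sphere 0 1) * (sphericalGaussian V).real A := by
  have hS : MeasurableSet (Metric.sphere (0 : V) 1) := Metric.isClosed_sphere.measurableSet
  have hdec : ∀ {B : Set V}, MeasurableSet B → ν B =
      ν.toJordanDecomposition.posPart.real B - ν.toJordanDecomposition.negPart.real B :=
    fun hB => ν.apply_eq_posPart_real_sub_negPart_real hB
  set p := ν.toJordanDecomposition.posPart
  set n := ν.toJordanDecomposition.negPart
  have hae : ∀ q : Measure V, ∀ᵐ x ∂(q.restrict (Metric.sphere 0 1)), ‖x‖ = 1 := by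
    intro q
    filter_upwards [ae_restrict_mem hS] with x hx
    simpa using hx
  have h := real_sub_real_eq_of_reflection_invariant
    (p.restrict (Metric.sphere 0 1)) (n.restrict (Metric.sphere 0 1)) (sphericalGaussian V)
    (hae p) (hae n) sphericalGaussian_norm_eq_one ?_ sphericalGaussian_map A
  · rw [measureReal_restrict_apply hA, measureReal_restrict_apply hA,
      measureReal_restrict_apply .univ, measureReal_restrict_apply .univ, Set.univ_inter] at h
    rw [hdec (hA.inter hS), hdec hS, h]
  -- Only the difference of the Jordan parts has to be invariant, so no uniqueness of the
  -- decomposition is needed.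
  · intro w
    ext B hB
    have hR : Measurable (hyperplaneReflection w : V → V) := by fun_prop
    have hpre : hyperplaneReflection w ⁻¹' B ∩ Metric.sphere 0 1 =
        hyperplaneReflection w ⁻¹' (B ∩ Metric.sphere 0 1) := by
      ext x; simp
    have h1 := hν w _ (hB.inter hS) Set.inter_subset_right
    rw [hdec (hB.inter hS), hdec (hR (hB.inter hS))] at h1
    rw [← measureReal_eq_measureReal_iff, measureReal_add_apply, measureReal_add_apply,
      map_measureReal_apply hR hB, map_measureReal_apply hR hB,
      measureReal_restrict_apply hB, measureReal_restrict_apply hB,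
      measureReal_restrict_apply (hR hB), measureReal_restrict_apply (hR hB), hpre]
    linarith

end Reflection

namespace PolyhedralCone

variable {d : ℕ}

/-! ### Relative interiors of faces -/

theorem mem_relInterior_iff {L : Submodule ℝ (E d)} {A : Set (E d)} {x : E d} :
    x ∈ relInterior L A ↔ x ∈ L ∧ ∀ᶠ y in nhds x, y ∈ L → y ∈ A := by
  constructor
  · rintro ⟨y, hy, rfl⟩
    refine ⟨y.2, ?_⟩
    rw [mem_interior_iff_mem_nhds, mem_nhds_subtype_iff_nhdsWithin, mem_nhdsWithin_iff_eventually]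
      at hy
    filter_upwards [hy] with z hz hzL
    obtain ⟨w, hw, rfl⟩ := hz hzL
    exact hw
  · rintro ⟨hx, h⟩
    refine ⟨⟨x, hx⟩, ?_, rfl⟩
    rw [mem_interior_iff_mem_nhds, mem_nhds_subtype_iff_nhdsWithin, mem_nhdsWithin_iff_eventually]
    filter_upwards [h] with z hz hzL
    exact ⟨⟨z, hzL⟩, hz hzL, rfl⟩

theorem relInterior_subset {L : Submodule ℝ (E d)} {A : Set (E d)} :
    relInterior L A ⊆ A ∩ L := by
  intro x hx
  have h := mem_relInterior_iff.1 hx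
  exact ⟨h.2.self_of_nhds h.1, h.1⟩

theorem measurableSet_relInterior (L : Submodule ℝ (E d)) (A : Set (E d)) :
    MeasurableSet (relInterior L A) :=
  (MeasurableEmbedding.subtype_coe L.closed_of_finiteDimensional.measurableSet).measurableSet_image.2
    isOpen_interior.measurableSet

theorem smul_mem_carrier_iff (C : PolyhedralCone d) {r : ℝ} (hr : 0 < r) {x : E d} :
    r • x ∈ C.carrier ↔ x ∈ C.carrier := by
  constructor
  · intro h
    have := C.1.smul_mem (inv_nonneg.2 hr.le) h
    rwa [inv_smul_smul₀ hr.ne'] at this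
  · exact fun h => C.1.smul_mem hr.le h

/-- The linear span of the minimal face containing a point of its relative interior consists of the
directions of the segments through the point. -/
theorem mem_faceSpan_iff {C : PolyhedralCone d} {k : ℕ} {L : Submodule ℝ (E d)}
    (hL : L ∈ C.faceSpans k) {x : E d} (hx : x ∈ relInterior L C.carrier) (v : E d) :
    v ∈ L ↔ ∃ ε : ℝ, 0 < ε ∧ x + ε • v ∈ C.carrier ∧ x - ε • v ∈ C.carrier := by
  obtain ⟨⟨F, ⟨z, hz, rfl⟩, rfl⟩, -⟩ := hL
  obtain ⟨hxL, hev⟩ := mem_relInterior_iff.1 hx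
  constructor
  · intro hv
    have h1 : ∀ᶠ ε : ℝ in nhds 0, x + ε • v ∈ C.carrier := by
      have hc : Filter.Tendsto (fun ε : ℝ => x + ε • v) (nhds 0) (nhds x) := by
        have : Continuous fun ε : ℝ => x + ε • v := by fun_prop
        simpa using this.tendsto 0
      filter_upwards [hc.eventually hev] with ε hε
      exact hε (Submodule.add_mem _ hxL (Submodule.smul_mem _ _ hv))
    have h2 : ∀ᶠ ε : ℝ in nhds 0, x - ε • v ∈ C.carrier := by
      have hc : Filter.Tendsto (fun ε : ℝ => x - ε • v) (nhds 0) (nhds x) := by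
        have : Continuous fun ε : ℝ => x - ε • v := by fun_prop
        simpa using this.tendsto 0
      filter_upwards [hc.eventually hev] with ε hε
      exact hε (Submodule.sub_mem _ hxL (Submodule.smul_mem _ _ hv))
    obtain ⟨ε, hε, hε0⟩ := (((h1.and h2).filter_mono nhdsWithin_le_nhds).and
      (self_mem_nhdsWithin : Set.Ioi (0 : ℝ) ∈ nhdsWithin 0 (Set.Ioi 0))).exists
    exact ⟨ε, hε0, hε⟩
  · rintro ⟨ε, hε, h1, h2⟩
    -- As `x` is orthogonal to `z`, the supporting inequality at `x + ε • v` and `x - ε • v` forces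
    -- `⟪v, z⟫ = 0`, which puts `x + ε • v` in the face.
    have hxz : inner ℝ x z = 0 := by
      have : Submodule.span ℝ {x ∈ C.carrier | inner ℝ x z = 0} ≤ (ℝ ∙ z)ᗮ := by
        rw [Submodule.span_le]
        intro y hy
        exact Submodule.mem_orthogonal_singleton_iff_inner_left.2 hy.2
      exact Submodule.mem_orthogonal_singleton_iff_inner_left.1 (this hxL)
    have h3 := hz _ h1
    have h4 := hz _ h2
    rw [inner_add_left, real_inner_smul_left, hxz] at h3
    rw [inner_sub_left, real_inner_smul_left, hxz] at h4
    have hmem : x + ε • v ∈ Submodule.span ℝ {x ∈ C.carrier | inner ℝ x z = 0} := by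
      refine Submodule.subset_span ⟨h1, ?_⟩
      rw [inner_add_left, real_inner_smul_left, hxz]
      linarith
    have := Submodule.smul_mem _ ε⁻¹ (Submodule.sub_mem _ hmem hxL)
    rwa [add_sub_cancel_left, inv_smul_smul₀ hε.ne'] at this

/-- The criterion `mem_faceSpan_iff` describes the span through `x` and `C` only. -/
theorem faceSpans_eq_of_mem_relInterior {C : PolyhedralCone d} {j k : ℕ}
    {L L' : Submodule ℝ (E d)} (hL : L ∈ C.faceSpans k) (hL' : L' ∈ C.faceSpans j) {x : E d}
    (hx : x ∈ relInterior L C.carrier) (hx' : x ∈ relInterior L' C.carrier) : L = L' := by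
  ext v
  rw [mem_faceSpan_iff hL hx, mem_faceSpan_iff hL' hx']

/-- The minimal face of `x` is exposed by minus the sum of the constraints active at `x`: a sum of
nonnegative terms vanishes only if each term does. On its span the active constraints vanish, and
the others stay strict near `x`. -/
theorem exists_mem_relInterior {C : PolyhedralCone d} {x : E d} (hx : x ∈ C.carrier) :
    ∃ k ≤ d, ∃ L ∈ C.faceSpans k, x ∈ relInterior L C.carrier := by
  classical
  obtain ⟨s, hs⟩ := C.exists_halfspaces
  set I := s.filter fun a => inner ℝ a x = 0 with hI
  have hnn : ∀ y ∈ C.carrier, ∀ a ∈ I, 0 ≤ (inner ℝ y a : ℝ) := fun y hy a ha => by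
    rw [real_inner_comm]
    exact (hs y).1 hy a (Finset.mem_filter.1 ha).1
  set F : Set (E d) := {y ∈ C.carrier | inner ℝ y (-∑ a ∈ I, a) = 0} with hF
  have hface : C.IsFace F := by
    refine ⟨-∑ a ∈ I, a, fun y hy => ?_, rfl⟩
    rw [inner_neg_right, inner_sum, neg_nonpos]
    exact Finset.sum_nonneg (hnn y hy)
  have hFI : ∀ y ∈ F, ∀ a ∈ I, inner ℝ y a = 0 := by
    rintro y ⟨hy, h0⟩
    rw [inner_neg_right, inner_sum, neg_eq_zero, Finset.sum_eq_zero_iff_of_nonneg (hnn y hy)] at h0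
    exact h0
  have hxF : x ∈ F := by
    refine ⟨hx, ?_⟩
    rw [inner_neg_right, inner_sum, neg_eq_zero]
    refine Finset.sum_eq_zero fun a ha => ?_
    rw [real_inner_comm]
    exact (Finset.mem_filter.1 ha).2
  have hspan : ∀ y ∈ Submodule.span ℝ F, ∀ a ∈ I, inner ℝ a y = 0 := by
    intro y hy a ha
    have : Submodule.span ℝ F ≤ (ℝ ∙ a)ᗮ := by
      rw [Submodule.span_le]
      intro y hy
      exact Submodule.mem_orthogonal_singleton_iff_inner_left.2 (hFI y hy a ha)
    exact Submodule.mem_orthogonal_singleton_iff_inner_right.1 (this hy)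
  refine ⟨Module.finrank ℝ (Submodule.span ℝ F), ?_, Submodule.span ℝ F, ⟨⟨F, hface, rfl⟩, rfl⟩, ?_⟩
  · simpa using Submodule.finrank_le (Submodule.span ℝ F)
  · refine mem_relInterior_iff.2 ⟨Submodule.subset_span hxF, ?_⟩
    have hev : ∀ᶠ y in nhds x, ∀ a ∈ s \ I, 0 < inner ℝ a y := by
      rw [Filter.eventually_all_finset]
      intro a ha
      have hc : Continuous fun y : E d => (inner ℝ a y : ℝ) := by fun_prop
      refine hc.continuousAt.eventually (lt_mem_nhds ?_)
      have ha' := Finset.mem_sdiff.1 ha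
      exact lt_of_le_of_ne ((hs x).1 hx a ha'.1)
        fun h => ha'.2 (Finset.mem_filter.2 ⟨ha'.1, h.symm⟩)
    filter_upwards [hev] with y hy hyL
    refine (hs y).2 fun a ha => ?_
    by_cases haI : a ∈ I
    · exact (hspan y hyL a haI).ge
    · exact (hy a (Finset.mem_sdiff.2 ⟨ha, haI⟩)).le

/-- Points of `L` in the cone outside of the relative interior lie on finitely many hyperplanes. -/
theorem exists_hyperplanes (C : PolyhedralCone d) (L : Submodule ℝ (E d)) :
    ∃ t : Finset L, (∀ a ∈ t, a ≠ 0) ∧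
      ∀ y : L, (y : E d) ∈ C.carrier → (y : E d) ∉ relInterior L C.carrier →
        ∃ a ∈ t, inner ℝ a y = 0 := by
  classical
  obtain ⟨s, hs⟩ := C.exists_halfspaces
  have hproj : ∀ (a : E d) (y : L), inner ℝ (L.orthogonalProjectionOnto a) y = inner ℝ a (y : E d) :=
    fun a y => by
      rw [Submodule.coe_inner]
      exact Submodule.inner_orthogonalProjectionOnto_eq_of_mem_right y a
  -- A constraint whose projection to `L` is zero holds trivially on `L`; the other projections give
  -- the hyperplanes.
  refine ⟨(s.image fun a => L.orthogonalProjectionOnto a).filter (· ≠ 0),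
    fun a ha => (Finset.mem_filter.1 ha).2, fun y hy hyn => ?_⟩
  by_contra! hcon
  refine hyn (mem_relInterior_iff.2 ⟨y.2, ?_⟩)
  have hev : ∀ᶠ z in nhds (y : E d), ∀ a ∈ s.filter fun a => L.orthogonalProjectionOnto a ≠ 0,
      0 < inner ℝ a z := by
    rw [Filter.eventually_all_finset]
    intro a ha
    have ha' := Finset.mem_filter.1 ha
    have hc : Continuous fun y : E d => (inner ℝ a y : ℝ) := by fun_prop
    refine hc.continuousAt.eventually (lt_mem_nhds (lt_of_le_of_ne ((hs y).1 hy a ha'.1) ?_))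
    change 0 ≠ inner ℝ a (y : E d)
    rw [← hproj]
    exact (hcon _ (Finset.mem_filter.2 ⟨Finset.mem_image_of_mem _ ha'.1, ha'.2⟩)).symm
  filter_upwards [hev] with z hz hzL
  refine (hs z).2 fun a ha => ?_
  by_cases h0 : L.orthogonalProjectionOnto a = 0
  · have := hproj a ⟨z, hzL⟩
    rw [h0, inner_zero_left] at this
    exact this.le
  · exact (hz a (Finset.mem_filter.2 ⟨ha, h0⟩)).le

theorem skeleton_inter_of_subset_relInterior {C : PolyhedralCone d} {k : ℕ}
    {L : Submodule ℝ (E d)} (hL : L ∈ C.faceSpans k) {M : Set (E d)}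
    (hM : M ⊆ relInterior L C.carrier) (j : ℕ) :
    C.skeleton j ∩ M = {x ∈ M | j = k} := by
  ext x
  simp only [skeleton, Set.mem_inter_iff, Set.mem_iUnion, exists_prop, Set.mem_ofPred_eq]
  constructor
  · rintro ⟨⟨L', hL', hx'⟩, hx⟩
    refine ⟨hx, ?_⟩
    rw [← hL.2, ← hL'.2, faceSpans_eq_of_mem_relInterior hL hL' (hM hx) hx']
  · rintro ⟨hx, rfl⟩
    exact ⟨⟨L, hL, hM hx⟩, hx⟩

theorem carrier_ofSubspace (L : Submodule ℝ (E d)) : (ofSubspace L).carrier = L := rfl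

theorem mem_faceSpans_ofSubspace (L : Submodule ℝ (E d)) :
    L ∈ (ofSubspace L).faceSpans (Module.finrank ℝ L) := by
  refine ⟨⟨L, ⟨0, by simp, ?_⟩, by simp⟩, rfl⟩
  ext; simp [carrier_ofSubspace]

theorem relInterior_coe (L : Submodule ℝ (E d)) : relInterior L (L : Set (E d)) = L := by
  ext x
  rw [mem_relInterior_iff]
  simp

/-- At `x = 0` the criterion `mem_faceSpan_iff` asks that both `v` and `-v` lie in `C`. -/
theorem lineal_mem_faceSpans (C : PolyhedralCone d) :
    C.1.lineal ∈ C.faceSpans C.lin ∧ (0 : E d) ∈ relInterior C.1.lineal C.carrier := by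
  obtain ⟨k, -, L, hL, h0⟩ := exists_mem_relInterior (C := C) (x := 0) C.1.zero_mem
  have hLl : L = C.1.lineal := by
    ext v
    rw [mem_faceSpan_iff hL h0, PointedCone.mem_lineal]
    constructor
    · rintro ⟨ε, hε, h1, h2⟩
      rw [zero_add, smul_mem_carrier_iff C hε] at h1
      rw [zero_sub, ← smul_neg, smul_mem_carrier_iff C hε] at h2
      exact ⟨h1, h2⟩
    · rintro ⟨h1, h2⟩
      refine ⟨1, one_pos, ?_, ?_⟩
      · rw [zero_add, one_smul]; exact h1
      · rw [zero_sub, one_smul]; exact h2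
  subst hLl
  exact ⟨⟨hL.1, rfl⟩, h0⟩

theorem lin_ofSubspace (L : Submodule ℝ (E d)) : (ofSubspace L).lin = Module.finrank ℝ L := by
  have h := lineal_mem_faceSpans (ofSubspace L)
  have h2 := faceSpans_eq_of_mem_relInterior h.1 (mem_faceSpans_ofSubspace L) h.2
    (by rw [carrier_ofSubspace, relInterior_coe]; exact L.zero_mem)
  rw [lin, h2]

theorem rotate_ofSubspace (Q : E d ≃ₗᵢ[ℝ] E d) (L : Submodule ℝ (E d)) :
    (ofSubspace L).rotate Q = ofSubspace (L.map (Q.toLinearEquiv : E d →ₗ[ℝ] E d)) := by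
  refine Subtype.ext ?_
  ext x
  simp only [rotate, ofSubspace, PointedCone.mem_map, PointedCone.mem_ofSubmodule_iff,
    Submodule.mem_map]

end PolyhedralCone

/-! ### Gaussian measures on subspaces -/

section Gaussian

variable {d : ℕ}

theorem gaussianOn_real_apply (L : Submodule ℝ (E d)) {A : Set (E d)} (hA : MeasurableSet A) :
    (gaussianOn L).real A = (stdGaussian L).real (((↑) : L → E d) ⁻¹' A) :=
  map_measureReal_apply (by fun_prop) hA

/-- The relative boundary of a polyhedral cone is a null set of the Gaussian measure. -/
theorem gaussianOn_real_inter_relInterior (C : PolyhedralCone d) (L : Submodule ℝ (E d))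
    {M : Set (E d)} (hM : MeasurableSet M) :
    (gaussianOn L).real (C.carrier ∩ L ∩ M) =
      (gaussianOn L).real (PolyhedralCone.relInterior L C.carrier ∩ M) := by
  have hL : MeasurableSet (L : Set (E d)) := L.closed_of_finiteDimensional.measurableSet
  rw [gaussianOn_real_apply L ((C.isClosed_carrier.measurableSet.inter hL).inter hM),
    gaussianOn_real_apply L ((PolyhedralCone.measurableSet_relInterior L _).inter hM)]
  obtain ⟨t, ht0, ht⟩ := C.exists_hyperplanes L
  have hnull : stdGaussian L (⋃ a ∈ t, {y | inner ℝ a y = 0}) = 0 := by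
    refine (measure_biUnion_null_iff t.countable_toSet).2 ?_
    exact fun a ha => stdGaussian_inner_eq_zero (ht0 a ha)
  refine measureReal_congr ?_
  have hae : ∀ᵐ y ∂(stdGaussian L), y ∉ ⋃ a ∈ t, {y : L | inner ℝ a y = 0} :=
    measure_eq_zero_iff_ae_notMem.1 hnull
  filter_upwards [hae] with y hy
  refine propext ⟨?_, ?_⟩
  · rintro ⟨⟨h1, h2⟩, h3⟩
    refine ⟨?_, h3⟩
    by_contra hcon
    obtain ⟨a, ha, h⟩ := ht y h1 hcon
    exact hy (Set.mem_biUnion ha h)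
  · rintro ⟨h1, h2⟩
    exact ⟨PolyhedralCone.relInterior_subset h1, h2⟩

theorem gaussianOn_real_eq_sphericalGaussian (L : Submodule ℝ (E d)) (M : ConicSet d) :
    (gaussianOn L).real M.1 = (sphericalGaussian L).real (((↑) : L → E d) ⁻¹' M.1) := by
  rw [gaussianOn_real_apply L M.2.1, sphericalGaussian, map_measureReal_apply (by fun_prop)
    (measurable_subtype_coe M.2.1)]
  congr 1
  ext x
  simp only [Set.mem_preimage, Submodule.coe_smul]
  rcases eq_or_ne x 0 with rfl | hx
  -- The convention `0⁻¹ = 0` makes normalization fix the origin.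
  · simp
  · have hpos : 0 < ‖x‖⁻¹ := inv_pos.2 (norm_pos_iff.2 hx)
    conv_rhs => rw [← M.2.2 _ hpos, Set.smul_mem_smul_set_iff₀ hpos.ne']

theorem gaussianOn_real_diff_zero {L : Submodule ℝ (E d)} (hL : L ≠ ⊥) (M : Set (E d)) :
    (gaussianOn L).real (M \ {0}) = (gaussianOn L).real M := by
  have : Nontrivial L := Submodule.nontrivial_iff_ne_bot.2 hL
  have h0 : gaussianOn L {0} = 0 := by
    rw [gaussianOn, Measure.map_apply (by fun_prop) (measurableSet_singleton 0)]
    refine measure_mono_null ?_ (stdGaussian_singleton_zero (V := L))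
    intro x hx
    simpa using hx
  exact measureReal_congr (sdiff_null_ae_eq_self h0)

theorem gaussianOn_bot : gaussianOn (⊥ : Submodule ℝ (E d)) = Measure.dirac 0 := by
  ext A hA
  rw [gaussianOn, Measure.map_apply (by fun_prop) hA, Measure.dirac_apply' _ hA]
  by_cases h : (0 : E d) ∈ A
  · have : ((↑) : (⊥ : Submodule ℝ (E d)) → E d) ⁻¹' A = Set.univ := by
      ext x; simp [Subsingleton.elim x 0, h]
    simp [this, h]
  · have : ((↑) : (⊥ : Submodule ℝ (E d)) → E d) ⁻¹' A = ∅ := by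
      ext x; simp [Subsingleton.elim x 0, h]
    simp [this, h]

/-- A zero-dimensional face span has `0` in its relative interior, so it must be the lineality
space. Hence `faceSpans C 0` is `{⊥}` or empty according to whether `C.lin = 0`. -/
theorem linMeasure_zero_eq_polyMeasure_zero :
    linMeasure (d := d) 0 = polyMeasure 0 := by
  funext C M
  have hl := C.lineal_mem_faceSpans
  rw [linMeasure, polyMeasure]
  by_cases h : C.lin = 0
  · have hbot : C.1.lineal = ⊥ := Submodule.finrank_eq_zero.1 h
    rw [hbot, h] at hl
    have : (C.finite_faceSpans 0).toFinset = {⊥} := by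
      ext L
      rw [Set.Finite.mem_toFinset, Finset.mem_singleton]
      exact ⟨fun hL => Submodule.finrank_eq_zero.1 hL.2, fun hL => hL ▸ hl.1⟩
    rw [this, Finset.sum_singleton, gaussianOn_bot, if_pos h, one_mul]
    have hm : MeasurableSet (C.carrier ∩ ((⊥ : Submodule ℝ (E d)) : Set (E d))) :=
      C.isClosed_carrier.measurableSet.inter (by simp)
    have h0 : (0 : E d) ∈ C.carrier ∩ ((⊥ : Submodule ℝ (E d)) : Set (E d)) :=
      ⟨C.1.zero_mem, by simp⟩
    simp only [Measure.real]
    rw [Measure.dirac_apply' _ M.2.1,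
      Measure.dirac_apply' _ (hm.inter M.2.1)]
    congr 1
    by_cases hM : (0 : E d) ∈ M.1 <;> simp [Set.indicator, h0.1, hM]
  · have : (C.finite_faceSpans 0).toFinset = ∅ := by
      ext L
      simp only [Set.Finite.mem_toFinset, Finset.notMem_empty, iff_false]
      intro hL
      refine h ?_
      have hbot : L = ⊥ := Submodule.finrank_eq_zero.1 hL.2
      have h0 : (0 : E d) ∈ PolyhedralCone.relInterior L C.carrier := by
        refine PolyhedralCone.mem_relInterior_iff.2 ⟨L.zero_mem, .of_forall fun y hy => ?_⟩
        rw [hbot, Submodule.mem_bot] at hy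
        exact hy ▸ C.1.zero_mem
      have := PolyhedralCone.faceSpans_eq_of_mem_relInterior hL hl.1 h0 hl.2
      rw [PolyhedralCone.lin, ← this, hL.2]
    rw [this, if_neg h]
    simp

end Gaussian

/-! ### Conic measures on a subspace -/

/-- The abstract source allows the σ-algebra `conicBorel d` in place of the Borel instance on `E d`.
-/
theorem exists_signedMeasure_map_restrict {α β : Type*} [MeasurableSpace α] [MeasurableSpace β]
    (m : SignedMeasure α) {ρ : α → β} (hρ : Measurable ρ) {S : Set α} (hS : MeasurableSet S) :
    ∃ ν : SignedMeasure β, ∀ A, MeasurableSet A → ν A = m (ρ ⁻¹' A ∩ S) :=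
  ⟨(m.restrict S).map ρ, fun A hA => by
    rw [VectorMeasure.map_apply _ hρ hA, VectorMeasure.restrict_apply _ hS (hρ hA)]⟩

theorem signedMeasure_biUnion_finset {α ι : Type*} [MeasurableSpace α] (m : SignedMeasure α)
    (t : Finset ι) {f : ι → Set α} (hf : ∀ i ∈ t, MeasurableSet (f i))
    (hd : Set.PairwiseDisjoint (t : Set ι) f) : m (⋃ i ∈ t, f i) = ∑ i ∈ t, m (f i) := by
  classical
  induction t using Finset.induction_on with
  | empty => simp
  | insert a t ha ih =>
    rw [Finset.set_biUnion_insert, VectorMeasure.of_union, Finset.sum_insert ha,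
      ih (fun i hi => hf i (Finset.mem_insert_of_mem hi)) (hd.subset (by simp))]
    · rw [Set.disjoint_iUnion₂_right]
      intro i hi
      exact hd (by simp) (by simp [hi]) (fun h => ha (h ▸ hi))
    · exact hf a (Finset.mem_insert_self a t)
    · exact Finset.measurableSet_biUnion _ fun i hi => hf i (Finset.mem_insert_of_mem hi)

variable {d : ℕ}

/-- The radial projection onto the unit sphere of a subspace. -/
def radialProjection (L : Submodule ℝ (E d)) (x : E d) : L :=
  ‖L.orthogonalProjectionOnto x‖⁻¹ • L.orthogonalProjectionOnto x

theorem radialProjection_coe {L : Submodule ℝ (E d)} (x : L) :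
    radialProjection L x = ‖x‖⁻¹ • x := by
  rw [radialProjection, Submodule.orthogonalProjectionOnto_mem_subspace_eq_self]

/-- The map is constant on open rays from the origin, so preimages of Borel sets are conic. A conic
measure can thus be pushed forward to a Borel signed measure on `L`. -/
theorem measurable_radialProjection (L : Submodule ℝ (E d)) :
    @Measurable _ _ (conicBorel d) _ (radialProjection L) := by
  intro A hA
  have hm : Measurable (radialProjection L) := by
    unfold radialProjection
    fun_prop
  refine ⟨hm hA, fun r hr => ?_⟩
  ext x
  rw [Set.mem_smul_set_iff_inv_smul_mem₀ hr.ne', Set.mem_preimage, Set.mem_preimage]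
  have : radialProjection L (r⁻¹ • x) = radialProjection L x := by
    have hr' := inv_pos.2 hr
    rw [radialProjection, map_smul, norm_smul, Real.norm_of_nonneg hr'.le, mul_inv, smul_smul,
      mul_right_comm, inv_mul_cancel₀ hr'.ne', one_mul, radialProjection]
  rw [this]

theorem smul_mem_iff_of_conic {M : Set (E d)} (hM : MeasurableSet[conicBorel d] M) {r : ℝ}
    (hr : 0 < r) {x : E d} : r • x ∈ M ↔ x ∈ M := by
  conv_lhs => rw [← hM.2 r hr, Set.smul_mem_smul_set_iff₀ hr.ne']

theorem measurableSet_conicBorel_of {M : Set (E d)} (hM : MeasurableSet M)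
    (h : ∀ r : ℝ, 0 < r → ∀ x ∈ M, r • x ∈ M) : MeasurableSet[conicBorel d] M := by
  refine ⟨hM, fun r hr => ?_⟩
  ext x
  rw [Set.mem_smul_set_iff_inv_smul_mem₀ hr.ne']
  refine ⟨fun hx => ?_, fun hx => h _ (inv_pos.2 hr) _ hx⟩
  simpa [smul_inv_smul₀ hr.ne'] using h r hr _ hx

theorem measurableSet_conicBorel_submodule (L : Submodule ℝ (E d)) :
    MeasurableSet[conicBorel d] (L : Set (E d)) :=
  measurableSet_conicBorel_of L.closed_of_finiteDimensional.measurableSet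
    fun r _ _ hx => L.smul_mem r hx

theorem measurableSet_conicBorel_relInterior (C : PolyhedralCone d) (L : Submodule ℝ (E d)) :
    MeasurableSet[conicBorel d] (PolyhedralCone.relInterior L C.carrier) := by
  refine measurableSet_conicBorel_of (PolyhedralCone.measurableSet_relInterior L _) ?_
  intro r hr x hx
  obtain ⟨hxL, hev⟩ := PolyhedralCone.mem_relInterior_iff.1 hx
  refine PolyhedralCone.mem_relInterior_iff.2 ⟨L.smul_mem r hxL, ?_⟩
  have hc : Filter.Tendsto (fun y : E d => r⁻¹ • y) (nhds (r • x)) (nhds x) := by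
    have : Continuous fun y : E d => r⁻¹ • y := by fun_prop
    simpa [inv_smul_smul₀ hr.ne'] using this.tendsto (r • x)
  filter_upwards [hc.eventually hev] with y hy hyL
  exact (C.smul_mem_carrier_iff (inv_pos.2 hr)).1 (hy (L.smul_mem _ hyL))

/-- Every reflection of `L` extends to one of the ambient space, so invariance under orthogonal maps
of `E d` passes to `L`. -/
theorem hyperplaneReflection_coe {L : Submodule ℝ (E d)} (w x : L) :
    hyperplaneReflection (w : E d) (x : E d) = (hyperplaneReflection w x : L) := by
  simp [hyperplaneReflection_apply]

theorem map_hyperplaneReflection {L : Submodule ℝ (E d)} (w : L) :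
    L.map ((hyperplaneReflection (w : E d)).toLinearEquiv : E d →ₗ[ℝ] E d) = L := by
  ext x
  rw [Submodule.mem_map]
  constructor
  · rintro ⟨y, hy, rfl⟩
    have := hyperplaneReflection_coe w ⟨y, hy⟩
    exact this ▸ Subtype.coe_prop _
  · intro hx
    refine ⟨hyperplaneReflection (w : E d) x, ?_, hyperplaneReflection_involutive _ x⟩
    have := hyperplaneReflection_coe w ⟨x, hx⟩
    exact this ▸ Subtype.coe_prop _

/-- A rotation invariant conic measure on a subspace is, away from the origin, a multiple of the
Gaussian measure. -/
theorem conicMeasure_eq_gaussianOn {L : Submodule ℝ (E d)} (hL : L ≠ ⊥)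
    (m : @SignedMeasure (E d) (conicBorel d))
    (hinv : ∀ (w : L) (M : ConicSet d), m (M.rotate (hyperplaneReflection (w : E d))).1 = m M.1)
    (M : ConicSet d) :
    m (M.1 ∩ (L \ {0})) = m (L \ {0}) * (gaussianOn L).real M.1 := by
  have : Nontrivial L := Submodule.nontrivial_iff_ne_bot.2 hL
  have hS : MeasurableSet[conicBorel d] ((L : Set (E d)) \ {0}) :=
    @MeasurableSet.diff _ (conicBorel d) _ _ (measurableSet_conicBorel_submodule L)
      (ConicSet.origin d).2
  have hρ := measurable_radialProjection L
  obtain ⟨ν, hν⟩ := @exists_signedMeasure_map_restrict _ _ (conicBorel d) _ m _ hρ _ hS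
  have hsph : MeasurableSet (Metric.sphere (0 : L) 1) := Metric.isClosed_sphere.measurableSet
  have hmem : ∀ x ∈ (L : Set (E d)) \ {0}, radialProjection L x ∈ Metric.sphere (0 : L) 1 := by
    rintro x ⟨hxL, hx0⟩
    lift x to L using hxL
    rw [radialProjection_coe, mem_sphere_zero_iff_norm]
    exact norm_smul_inv_norm (𝕜 := ℝ) (by simpa using hx0)
  have hM : MeasurableSet (((↑) : L → E d) ⁻¹' M.1) := measurable_subtype_coe M.2.1
  have key := signedMeasure_eq_sphericalGaussian ν ?_ hM
  · rw [hν _ (hM.inter hsph), hν _ hsph, ← gaussianOn_real_eq_sphericalGaussian] at key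
    convert key using 2
    · ext x
      refine and_congr_left fun hx => ?_
      have h1 := hmem x hx
      simp only [Set.mem_preimage, Set.mem_inter_iff, h1, and_true]
      obtain ⟨hxL, hx0⟩ := hx
      lift x to L using hxL
      rw [radialProjection_coe, Submodule.coe_smul, smul_mem_iff_of_conic M.2]
      exact inv_pos.2 (norm_pos_iff.2 (by simpa using hx0))
    · congr 1
      ext x
      exact ⟨fun hx => ⟨hmem x hx, hx⟩, fun hx => hx.2⟩
  · intro w A hA _
    have hR : Measurable (hyperplaneReflection w : L → L) := by fun_prop
    rw [hν _ hA, hν _ (hR hA)]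
    rw [← hinv w ⟨radialProjection L ⁻¹' A ∩ (L \ {0}),
      @MeasurableSet.inter _ (conicBorel d) _ _ (hρ hA) hS⟩]
    congr 1
    simp only [ConicSet.rotate]
    rw [Set.image_eq_preimage_of_inverse (hyperplaneReflection_involutive (w : E d)).leftInverse
      (hyperplaneReflection_involutive (w : E d)).rightInverse]
    ext x
    have hmemL : hyperplaneReflection (w : E d) x ∈ L ↔ x ∈ L := by
      have h : ∀ y ∈ L, hyperplaneReflection (w : E d) y ∈ L := fun y hy =>
        hyperplaneReflection_coe w ⟨y, hy⟩ ▸ Subtype.coe_prop _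
      refine ⟨fun hx => ?_, h x⟩
      have := h _ hx
      rwa [hyperplaneReflection_involutive] at this
    simp only [Set.mem_inter_iff, Set.mem_preimage, Set.mem_sdiff, SetLike.mem_coe, hmemL,
      Set.mem_singleton_iff, LinearIsometryEquiv.map_eq_zero_iff]
    refine and_congr_left fun hx => ?_
    obtain ⟨hxL, -⟩ := hx
    lift x to L using hxL
    -- Radial projection commutes with the reflections of `L`.
    rw [hyperplaneReflection_coe, radialProjection_coe, radialProjection_coe, map_smul,
      LinearIsometryEquiv.norm_map]

/-! ### Orthogonal transformations between subspaces -/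

/-- Orthonormal bases match `L` with `L'`; the isometry extends to `E d`, and is onto by dimension.
-/
theorem exists_isometryEquiv_map_eq {L L' : Submodule ℝ (E d)}
    (h : Module.finrank ℝ L = Module.finrank ℝ L') :
    ∃ Q : E d ≃ₗᵢ[ℝ] E d, L.map (Q.toLinearEquiv : E d →ₗ[ℝ] E d) = L' := by
  let e : L ≃ₗᵢ[ℝ] L' := (stdOrthonormalBasis ℝ L).equiv (stdOrthonormalBasis ℝ L') (finCongr h)
  let f : L →ₗᵢ[ℝ] E d := L'.subtypeₗᵢ.comp e.toLinearIsometry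
  refine ⟨f.extend.toLinearIsometryEquiv rfl, ?_⟩
  have hf : ∀ x : L, f.extend (x : E d) = e x := fun x => LinearIsometry.extend_apply f x
  ext y
  rw [Submodule.mem_map]
  constructor
  · rintro ⟨x, hx, rfl⟩
    have : f.extend x ∈ L' := by
      have := hf ⟨x, hx⟩
      exact this ▸ Subtype.coe_prop _
    exact this
  · intro hy
    refine ⟨e.symm ⟨y, hy⟩, Subtype.coe_prop _, ?_⟩
    have := hf (e.symm ⟨y, hy⟩)
    simpa using this

/-! ### Local rotation invariant functionals -/

section Functional

variable {d : ℕ} {ψ : PolyhedralCone d → ConicSet d → ℝ}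

/-- For both cones, `M` lies in the skeleton of index `dim L` and misses all others. -/
theorem eq_ofSubspace_of_subset_relInterior
    (locality : ∀ (C D : PolyhedralCone d) (M : ConicSet d),
      (∀ k ≤ d, C.skeleton k ∩ M.1 = D.skeleton k ∩ M.1) → ψ C M = ψ D M)
    {C : PolyhedralCone d} {k : ℕ} {L : Submodule ℝ (E d)} (hL : L ∈ C.faceSpans k)
    {M : ConicSet d} (hM : M.1 ⊆ PolyhedralCone.relInterior L C.carrier) :
    ψ C M = ψ (.ofSubspace L) M := by
  refine locality _ _ _ fun j _ => ?_
  rw [PolyhedralCone.skeleton_inter_of_subset_relInterior hL hM,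
    PolyhedralCone.skeleton_inter_of_subset_relInterior
      (PolyhedralCone.mem_faceSpans_ofSubspace L), hL.2]
  rw [PolyhedralCone.carrier_ofSubspace, PolyhedralCone.relInterior_coe]
  exact fun x hx => (PolyhedralCone.relInterior_subset (hM hx)).2

theorem apply_origin_congr
    (locality : ∀ (C D : PolyhedralCone d) (M : ConicSet d),
      (∀ k ≤ d, C.skeleton k ∩ M.1 = D.skeleton k ∩ M.1) → ψ C M = ψ D M)
    {C D : PolyhedralCone d} (h : C.lin = D.lin) : ψ C (.origin d) = ψ D (.origin d) := by
  refine locality _ _ _ fun j _ => ?_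
  have hC := C.lineal_mem_faceSpans
  have hD := D.lineal_mem_faceSpans
  exact (PolyhedralCone.skeleton_inter_of_subset_relInterior hC.1
    (Set.singleton_subset_iff.2 hC.2) j).trans (h ▸
      (PolyhedralCone.skeleton_inter_of_subset_relInterior hD.1
        (Set.singleton_subset_iff.2 hD.2) j).symm)

theorem apply_punctured_congr
    (invariance : ∀ (Q : E d ≃ₗᵢ[ℝ] E d) C M, ψ (C.rotate Q) (M.rotate Q) = ψ C M)
    {L L' : Submodule ℝ (E d)} (h : Module.finrank ℝ L = Module.finrank ℝ L') :
    ψ (.ofSubspace L) (.punctured d) = ψ (.ofSubspace L') (.punctured d) := by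
  obtain ⟨Q, rfl⟩ := exists_isometryEquiv_map_eq h
  have hQ : (ConicSet.punctured d).rotate Q = .punctured d := by
    refine Subtype.ext ?_
    simp only [ConicSet.rotate, ConicSet.punctured]
    rw [Set.image_compl_eq Q.bijective, Set.image_singleton, map_zero]
  rw [← PolyhedralCone.rotate_ofSubspace]
  conv_rhs => rw [← hQ]
  rw [invariance]

theorem ofSubspace_apply_eq_mul_gaussianOn
    (measure : ∀ C, IsConicMeasure (ψ C))
    (concentration : ∀ C M, ψ C M = ψ C (M.interCone C))
    (invariance : ∀ (Q : E d ≃ₗᵢ[ℝ] E d) C M, ψ (C.rotate Q) (M.rotate Q) = ψ C M)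
    {L : Submodule ℝ (E d)} (hL : L ≠ ⊥) {M : ConicSet d} (hM : M.1 ⊆ (L : Set (E d)) \ {0}) :
    ψ (.ofSubspace L) M = ψ (.ofSubspace L) (.punctured d) * (gaussianOn L).real M.1 := by
  obtain ⟨m, hm⟩ := measure (.ofSubspace L)
  have h := conicMeasure_eq_gaussianOn hL m (fun w N => ?_) M
  · rw [Set.inter_eq_left.2 hM] at h
    -- Concentration identifies the masses of `L \ {0}` and of the punctured space.
    rw [hm, h, concentration, hm]
    congr 2
    simp only [ConicSet.interCone, ConicSet.punctured, PolyhedralCone.carrier_ofSubspace]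
    rw [Set.inter_comm, Set.sdiff_eq]
  · have := invariance (hyperplaneReflection (w : E d)) (.ofSubspace L) N
    rwa [PolyhedralCone.rotate_ofSubspace, map_hyperplaneReflection, hm, hm] at this

theorem apply_eq_sum_gaussianOn
    (measure : ∀ C, IsConicMeasure (ψ C))
    (concentration : ∀ C M, ψ C M = ψ C (M.interCone C))
    (invariance : ∀ (Q : E d ≃ₗᵢ[ℝ] E d) C M, ψ (C.rotate Q) (M.rotate Q) = ψ C M)
    (locality : ∀ (C D : PolyhedralCone d) (M : ConicSet d),
      (∀ k ≤ d, C.skeleton k ∩ M.1 = D.skeleton k ∩ M.1) → ψ C M = ψ D M)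
    (C : PolyhedralCone d) (M : ConicSet d) :
    ψ C M = ψ C (.origin d) * (Measure.dirac (0 : E d)).real M.1 +
      ∑ k ∈ Finset.Icc 1 d, ∑ L ∈ (C.finite_faceSpans k).toFinset,
        ψ (.ofSubspace L) (.punctured d) * (gaussianOn L).real (C.carrier ∩ L ∩ M.1) := by
  classical
  obtain ⟨m, hm⟩ := measure C
  -- The origin is removed from every piece: it belongs to the lineality face, which may have
  -- positive dimension.
  let f : (Σ _ : ℕ, Submodule ℝ (E d)) → ConicSet d := fun i =>
    ⟨M.1 ∩ PolyhedralCone.relInterior i.2 C.carrier ∩ {0}ᶜ,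
      @MeasurableSet.inter _ (conicBorel d) _ _
        (@MeasurableSet.inter _ (conicBorel d) _ _ M.2
          (measurableSet_conicBorel_relInterior C i.2)) (ConicSet.punctured d).2⟩
  let t : Finset (Σ _ : ℕ, Submodule ℝ (E d)) :=
    (Finset.Icc 1 d).sigma fun k => (C.finite_faceSpans k).toFinset
  have ht : ∀ i ∈ t, 1 ≤ i.1 ∧ i.2 ∈ C.faceSpans i.1 := by
    intro i hi
    obtain ⟨h1, h2⟩ := Finset.mem_sigma.1 hi
    exact ⟨(Finset.mem_Icc.1 h1).1, by simpa using h2⟩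
  let M₀ : ConicSet d := ⟨M.1 ∩ {0},
    @MeasurableSet.inter _ (conicBorel d) _ _ M.2 (ConicSet.origin d).2⟩
  have hdecomp : (M.interCone C).1 = M₀.1 ∪ ⋃ i ∈ t, (f i).1 := by
    ext x
    simp only [ConicSet.interCone, M₀, f, Set.mem_union, Set.mem_inter_iff, Set.mem_iUnion,
      exists_prop, Set.mem_compl_iff, Set.mem_singleton_iff]
    constructor
    · rintro ⟨hxM, hxC⟩
      by_cases hx0 : x = 0
      · exact .inl ⟨hxM, hx0⟩
      · obtain ⟨k, hk, L, hL, hxL⟩ := PolyhedralCone.exists_mem_relInterior hxC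
        refine .inr ⟨⟨k, L⟩, Finset.mem_sigma.2 ⟨Finset.mem_Icc.2 ⟨?_, hk⟩, by simpa using hL⟩,
          ⟨hxM, hxL⟩, hx0⟩
        by_contra! hk0
        have hbot : L = ⊥ := Submodule.finrank_eq_zero.1 (by rw [hL.2]; lia)
        have := (PolyhedralCone.relInterior_subset hxL).2
        rw [hbot] at this
        exact hx0 (by simpa using this)
    · rintro (⟨hxM, rfl⟩ | ⟨i, -, ⟨hxM, hxL⟩, -⟩)
      · exact ⟨hxM, C.1.zero_mem⟩
      · exact ⟨hxM, (PolyhedralCone.relInterior_subset hxL).1⟩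
  have hdisj : Set.PairwiseDisjoint (t : Set (Σ _ : ℕ, Submodule ℝ (E d))) fun i => (f i).1 := by
    rintro ⟨k, L⟩ hi ⟨j, L'⟩ hi' hne
    refine Set.disjoint_left.2 fun x hx hx' => hne ?_
    have hL := (ht _ hi).2
    have hL' := (ht _ hi').2
    have hLL := PolyhedralCone.faceSpans_eq_of_mem_relInterior hL hL' hx.1.2 hx'.1.2
    simp only at hLL hL hL'
    subst hLL
    have : k = j := by rw [← hL.2, hL'.2]
    rw [this]
  have hsum : m (⋃ i ∈ t, (f i).1) = ∑ i ∈ t, m (f i).1 :=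
    @signedMeasure_biUnion_finset _ _ (conicBorel d) m t _ (fun i _ => (f i).2) hdisj
  have hmeas : MeasurableSet[conicBorel d] (⋃ i ∈ t, (f i).1) :=
    @Finset.measurableSet_biUnion _ _ (conicBorel d) _ t fun i _ => (f i).2
  have horigin : m M₀.1 = ψ C (.origin d) * (Measure.dirac (0 : E d)).real M.1 := by
    simp only [hm, Measure.real]
    rw [Measure.dirac_apply' _ M.2.1]
    by_cases h0 : (0 : E d) ∈ M.1
    · have : M₀.1 = (ConicSet.origin d).1 := Set.inter_eq_right.2 (by simpa using h0)
      simp [this, h0]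
    · have : M₀.1 = ∅ := Set.inter_singleton_eq_empty.2 h0
      simp [this, h0]
  rw [concentration, hm, hdecomp, @VectorMeasure.of_union _ (conicBorel d) _ _ _ m _ _ _ ?_ M₀.2 hmeas,
    hsum, horigin, Finset.sum_sigma]
  · congr 1
    refine Finset.sum_congr rfl fun k hk => Finset.sum_congr rfl fun L hL => ?_
    have hL' : L ∈ C.faceSpans k := by simpa using hL
    have hbot : L ≠ ⊥ := by
      rintro rfl
      have := hL'.2
      have := (Finset.mem_Icc.1 hk).1
      simp at *
      lia
    have hrel : (f ⟨k, L⟩).1 ⊆ PolyhedralCone.relInterior L C.carrier := fun x hx => hx.1.2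
    have hsub : (f ⟨k, L⟩).1 ⊆ (L : Set (E d)) \ {0} :=
      fun x hx => ⟨(PolyhedralCone.relInterior_subset hx.1.2).2, hx.2⟩
    rw [← hm, eq_ofSubspace_of_subset_relInterior locality hL' hrel,
      ofSubspace_apply_eq_mul_gaussianOn measure concentration invariance hbot hsub,
      gaussianOn_real_inter_relInterior C L M.2.1]
    congr 1
    simp only [f]
    -- The removed origin is put back at no cost, being a null set for `L ≠ ⊥`.
    rw [← Set.sdiff_eq, gaussianOn_real_diff_zero hbot, Set.inter_comm]
  · refine Set.disjoint_iUnion₂_right.2 fun i _ => Set.disjoint_left.2 fun x hx hx' => hx'.2 hx.2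

theorem eq_sum_linMeasure_add_sum_polyMeasure
    (measure : ∀ C, IsConicMeasure (ψ C))
    (concentration : ∀ C M, ψ C M = ψ C (M.interCone C))
    (invariance : ∀ (Q : E d ≃ₗᵢ[ℝ] E d) C M, ψ (C.rotate Q) (M.rotate Q) = ψ C M)
    (locality : ∀ (C D : PolyhedralCone d) (M : ConicSet d),
      (∀ k ≤ d, C.skeleton k ∩ M.1 = D.skeleton k ∩ M.1) → ψ C M = ψ D M)
    (L : ℕ → Submodule ℝ (E d)) (hL : ∀ k ≤ d, Module.finrank ℝ (L k) = k) :
    ψ = ∑ k ∈ Finset.Icc 0 d, ψ (.ofSubspace (L k)) (.origin d) • linMeasure k +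
          ∑ k ∈ Finset.Icc 1 d, ψ (.ofSubspace (L k)) (.punctured d) • polyMeasure k := by
  funext C M
  simp only [Pi.add_apply, Finset.sum_apply, Pi.smul_apply, smul_eq_mul]
  rw [apply_eq_sum_gaussianOn measure concentration invariance locality C M]
  have hlin : C.lin ≤ d := by
    simpa [PolyhedralCone.lin] using Submodule.finrank_le C.1.lineal
  congr 1
  · rw [Finset.sum_eq_single_of_mem C.lin (by simpa using hlin)]
    · rw [linMeasure, if_pos rfl, one_mul]
      congr 1
      exact apply_origin_congr locality (by rw [PolyhedralCone.lin_ofSubspace, hL _ hlin])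
    · intro k _ hk
      rw [linMeasure, if_neg hk.symm]
      simp
  · refine Finset.sum_congr rfl fun k hk => ?_
    rw [polyMeasure, Finset.mul_sum]
    refine Finset.sum_congr rfl fun N hN => ?_
    have hN' : N ∈ C.faceSpans k := by simpa using hN
    rw [apply_punctured_congr invariance
      (hN'.2.trans (hL k (Finset.mem_Icc.1 hk).2).symm)]

end Functional

theorem exists_submodule_finrank_eq (d : ℕ) :
    ∃ L : ℕ → Submodule ℝ (E d), ∀ k ≤ d, Module.finrank ℝ (L k) = k := by
  have h : ∀ k, ∃ N : Submodule ℝ (E d), k ≤ d → Module.finrank ℝ N = k := by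
    intro k
    by_cases hk : k ≤ d
    · obtain ⟨v, hv⟩ := exists_linearIndependent_of_le_finrank
        (R := ℝ) (M := E d) (n := k) (by simpa using hk)
      exact ⟨_, fun _ => (finrank_span_eq_card hv).trans (Fintype.card_fin k)⟩
    · exact ⟨⊥, fun h => absurd h hk⟩
  choose L hL using h
  exact ⟨L, hL⟩

end Conic

end

theorem mainTheorem5 (d : ℕ) (ψ : Conic.PolyhedralCone d → Conic.ConicSet d → ℝ)
    (measure : ∀ C, Conic.IsConicMeasure (ψ C))
    (concentration : ∀ C M, ψ C M = ψ C (M.interCone C))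
    (invariance : ∀ (Q : Conic.E d ≃ₗᵢ[ℝ] Conic.E d) C M, ψ (C.rotate Q) (M.rotate Q) = ψ C M)
    (locality : ∀ (C D : Conic.PolyhedralCone d) (M : Conic.ConicSet d),
      (∀ k ≤ d, C.skeleton k ∩ M.1 = D.skeleton k ∩ M.1) → ψ C M = ψ D M) :
    -- `Lin_0 = Ψ_0`, and `ψ` is a linear combination of `Lin_0, …, Lin_d, Ψ_1, …, Ψ_d`
    Conic.linMeasure (d := d) 0 = Conic.polyMeasure 0 ∧
    ψ ∈ Submodule.span ℝ
      (Conic.linMeasure '' Set.Icc 0 d ∪ Conic.polyMeasure '' Set.Icc 1 d) ∧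
    -- explicitly, for any choice of subspaces `L k` of dimension `k`
    ∀ L : ℕ → Submodule ℝ (Conic.E d), (∀ k ≤ d, Module.finrank ℝ (L k) = k) →
      ψ = ∑ k ∈ Finset.Icc 0 d,
            ψ (.ofSubspace (L k)) (.origin d) • Conic.linMeasure k +
          ∑ k ∈ Finset.Icc 1 d,
            ψ (.ofSubspace (L k)) (.punctured d) • Conic.polyMeasure k := by
  have h := Conic.eq_sum_linMeasure_add_sum_polyMeasure measure concentration invariance locality
  refine ⟨Conic.linMeasure_zero_eq_polyMeasure_zero, ?_, h⟩
  obtain ⟨L, hL⟩ := Conic.exists_submodule_finrank_eq d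
  rw [h L hL]
  refine Submodule.add_mem _ (Submodule.sum_mem _ fun k hk => Submodule.smul_mem _ _ ?_)
    (Submodule.sum_mem _ fun k hk => Submodule.smul_mem _ _ ?_)
  · exact Submodule.subset_span (.inl ⟨k, Finset.mem_Icc.1 hk, rfl⟩)
  · exact Submodule.subset_span (.inr ⟨k, Finset.mem_Icc.1 hk, rfl⟩)
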